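/- Let $n\ge 3$. There exist $\varepsilon_0>0$, $r_0>0$ and a function $C:(0,\varepsilon_0]\to\mathbb R$ with $C(\varepsilon)\to 0$ as $\varepsilon\to 0$, all depending only on $n$, such that the following holds. Let $\Omega\subseteq\mathbb R^n$ be open and let $u\in H^1(\Omega)\cap L^{2n/(n-2)}(\Omega)$ be a real-valued classical ($C^2$; in particular, any smooth) solution, of arbitrary sign, of $$-\Delta u=u\,|u|^{4/(n-2)}\quad\text{in }\Omega .$$ Let $x_0\in\Omega$ be such that the open ball $B(x_0,r_0)$ is contained in $\Omega$, and let $0<\varepsilon\le\varepsilon_0$. If $$\int_{B(x_0,r_0)}\Big(|\nabla u|^2+|u|^{2n/(n-2)}\Big)\,dx\le\varepsilon ,$$ then $$\|u\|_{L^\infty(B(x_0,r/2))}\le\frac{C(\varepsilon)}{r^{(n-2)/2}}\qquad\text{for all } 0<r<r_0 .$$ -/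

import Mathlib

open MeasureTheory Set Filter Topology

/-- The critical Sobolev exponent `2n/(n-2)`. -/
noncomputable def critExponent (n : ℕ) : ℝ := 2 * (n : ℝ) / ((n : ℝ) - 2)

/-- `u` (only its values on the open set `Ω` matter) is a classical solution of
`-Δ u = u |u| ^ (4/(n-2))` in `Ω`: it is of class `C²` on `Ω` and satisfies the equation at
every point of `Ω`. -/
structure IsClassicalSolution {n : ℕ} (Ω : Set (EuclideanSpace ℝ (Fin n)))
    (u : EuclideanSpace ℝ (Fin n) → ℝ) : Prop where
  contDiffOn : ContDiffOn ℝ 2 u Ω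
  eqn : ∀ x ∈ Ω, -(Laplacian.laplacian u x) = u x * |u x| ^ (4 / ((n : ℝ) - 2))

/-- `u ∈ H¹(Ω)` for a function `u` that is continuously differentiable on the open set `Ω`
(the weak gradient is then the classical one): `u` and `∇ u` are square integrable on `Ω`. -/
structure MemHOne {n : ℕ} (Ω : Set (EuclideanSpace ℝ (Fin n)))
    (u : EuclideanSpace ℝ (Fin n) → ℝ) : Prop where
  contDiffOn : ContDiffOn ℝ 1 u Ω
  memLp : MemLp u 2 (volume.restrict Ω)
  memLp_gradient : MemLp (gradient u) 2 (volume.restrict Ω)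

/-- `∫_{B(x,r)} (|∇ u|² + |u| ^ (2n/(n-2)))`. -/
noncomputable def ballEnergy {n : ℕ} (u : EuclideanSpace ℝ (Fin n) → ℝ)
    (x : EuclideanSpace ℝ (Fin n)) (r : ℝ) : ℝ :=
  ∫ y in Metric.ball x r, (‖gradient u y‖ ^ 2 + |u y| ^ critExponent n)

/-! ### Weighted mean values and the Laplacian. -/

section MeanValue

/-! The proof is a mean value estimate followed by point picking. With `w = 4(1-|y|²)₊` and `φ =
(1-|y|²)₊²` one has `∇φ = -w y`, so integrating by parts gives `d/dt ∫ w v(x+ty) = t ∫ φ Δv(x+ty)`.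
Together with Hölder this yields `|u(x)| ≤ A s² sup|Δu| + B (s⁻ⁿ ∫ |u|^q)^(1/q)` on balls of radius
`s` (`exists_abs_le_laplacian_add_Lp`). For `q = 2n/(n-2)` and `α = (n-2)/2`, the last term is at
most `B s^(-α) ε^(1/q)`.

In `exists_abs_le_of_critical_energy_small`, let `x₁` maximise `(3/4-|z-x₀|)^α |u(z)|`, and put `m =
|u(x₁)|`, `d = 3/4-|x₁-x₀|`. On the ball of radius `d/2` about `x₁`, `|u| ≤ 2^α m`, so `|Δu|` is at
most a constant times `m^(1+2/α)`. For `s ≤ a m^(-1/α)` the Laplacian term is absorbed into `m`,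
leaving `s^α m ≤ 2B ε^(1/q)`. Small `ε` forces `d/2 ≤ a m^(-1/α)`; then `s = d/2` bounds the
maximum, hence `u` on the half ball. -/

lemma hasDerivAt_max_zero_sq (r : ℝ) :
    HasDerivAt (fun r : ℝ => max r 0 ^ 2) (2 * max r 0) r := by
  rcases lt_trichotomy r 0 with h | rfl | h
  · have : (fun r : ℝ => max r 0 ^ 2) =ᶠ[𝓝 r] fun _ => 0 := by
      filter_upwards [Iio_mem_nhds h] with y hy
      simp [max_eq_right (le_of_lt (mem_Iio.1 hy))]
    rw [max_eq_right h.le, mul_zero]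
    exact (hasDerivAt_const r (0 : ℝ)).congr_of_eventuallyEq this
  · rw [max_self, mul_zero, hasDerivAt_iff_isLittleO]
    simp only [max_self, sub_zero, smul_zero, ne_eq, OfNat.ofNat_ne_zero, not_false_eq_true,
      zero_pow]
    have h1 : (fun r : ℝ => max r 0 ^ 2) =O[𝓝 0] fun r : ℝ => r ^ 2 := by
      refine Asymptotics.IsBigO.of_bound 1 (Eventually.of_forall fun y => ?_)
      rw [one_mul, norm_pow, norm_pow]
      gcongr
      simp only [Real.norm_eq_abs]
      rcases le_total y 0 with hy | hy <;> simp [hy]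
    exact h1.trans_isLittleO (Asymptotics.isLittleO_pow_id one_lt_two)
  · have : (fun r : ℝ => max r 0 ^ 2) =ᶠ[𝓝 r] fun r => r ^ 2 := by
      filter_upwards [Ioi_mem_nhds h] with y hy
      rw [max_eq_left (le_of_lt (mem_Ioi.1 hy))]
    rw [max_eq_left h.le]
    simpa using (hasDerivAt_pow 2 r).congr_of_eventuallyEq this

variable {E : Type*} [NormedAddCommGroup E]

/-- The potential `(1 - |y|²)₊²`, whose gradient is `- ballWeight y • y`. -/
noncomputable def ballPotential (y : E) : ℝ := max (1 - ‖y‖ ^ 2) 0 ^ 2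

/-- The averaging weight `4 (1 - |y|²)₊` on the unit ball. -/
noncomputable def ballWeight (y : E) : ℝ := 4 * max (1 - ‖y‖ ^ 2) 0

lemma continuous_ballPotential : Continuous (ballPotential : E → ℝ) := by
  unfold ballPotential; fun_prop

lemma continuous_ballWeight : Continuous (ballWeight : E → ℝ) := by
  unfold ballWeight; fun_prop

lemma ballPotential_nonneg (y : E) : 0 ≤ ballPotential y := by
  unfold ballPotential; positivity

lemma ballWeight_nonneg (y : E) : 0 ≤ ballWeight y := by
  unfold ballWeight; positivity

lemma ballWeight_le (y : E) : ballWeight y ≤ 4 := by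
  unfold ballWeight
  have : max (1 - ‖y‖ ^ 2) 0 ≤ 1 := max_le (by nlinarith [norm_nonneg y]) zero_le_one
  linarith

lemma max_one_sub_norm_sq_eq_zero {y : E} (hy : 1 ≤ ‖y‖) : max (1 - ‖y‖ ^ 2) 0 = 0 :=
  max_eq_right (by nlinarith)

lemma ballPotential_eq_zero {y : E} (hy : 1 ≤ ‖y‖) : ballPotential y = 0 := by
  simp [ballPotential, max_one_sub_norm_sq_eq_zero hy]

lemma ballWeight_eq_zero {y : E} (hy : 1 ≤ ‖y‖) : ballWeight y = 0 := by
  simp [ballWeight, max_one_sub_norm_sq_eq_zero hy]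

variable [InnerProductSpace ℝ E]

lemma hasFDerivAt_ballPotential (y : E) :
    HasFDerivAt (ballPotential : E → ℝ) (-(ballWeight y) • innerSL ℝ y) y := by
  have h1 : HasFDerivAt (fun y : E => 1 - ‖y‖ ^ 2) (-(2 • innerSL ℝ y)) y :=
    (hasStrictFDerivAt_norm_sq y).hasFDerivAt.const_sub 1
  have h2 := (hasDerivAt_max_zero_sq (1 - ‖y‖ ^ 2)).comp_hasFDerivAt y h1
  refine h2.congr_fderiv ?_
  ext w
  simp [ballWeight]
  ring

variable [FiniteDimensional ℝ E]

lemma hasCompactSupport_of_eq_zero_of_one_le_norm {f : E → ℝ} (hf : ∀ y, 1 ≤ ‖y‖ → f y = 0) :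
    HasCompactSupport f := by
  refine HasCompactSupport.intro (isCompact_closedBall (0 : E) 1) fun y hy => hf y ?_
  rw [mem_closedBall_zero_iff, not_le] at hy
  exact hy.le

/-- Multiplying by a bump function makes a local solution globally `C²`, so that whole-space
integration by parts applies. -/
lemma exists_contDiff_eqOn_ball {u : E → ℝ} {x : E} {s r : ℝ} (hs : 0 < s) (hsr : s < r)
    (hu : ContDiffOn ℝ 2 u (Metric.ball x r)) :
    ∃ v : E → ℝ, ContDiff ℝ 2 v ∧ EqOn v u (Metric.ball x s) := by
  let χ : ContDiffBump x := ⟨s, (s + r) / 2, hs, by linarith⟩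
  refine ⟨fun y => χ y * u y, contDiff_iff_contDiffAt.2 fun z => ?_, fun y hy => ?_⟩
  · by_cases hz : z ∈ Metric.ball x r
    · exact χ.contDiff.contDiffAt.mul (hu.contDiffAt (Metric.isOpen_ball.mem_nhds hz))
    · have : (fun y => χ y * u y) =ᶠ[𝓝 z] fun _ => 0 := by
        have hz' : z ∈ (Metric.closedBall x ((s + r) / 2))ᶜ := by
          simp only [Metric.mem_ball, not_lt, mem_compl_iff, Metric.mem_closedBall, not_le] at hz ⊢
          linarith
        filter_upwards [Metric.isClosed_closedBall.isOpen_compl.mem_nhds hz'] with y hy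
        rw [χ.zero_of_le_dist, zero_mul]
        simp only [mem_compl_iff, Metric.mem_closedBall, not_le] at hy
        exact hy.le
      exact contDiffAt_const.congr_of_eventuallyEq this
  · simp [χ.one_of_mem_closedBall (Metric.ball_subset_closedBall hy)]

variable [MeasurableSpace E] [BorelSpace E]

lemma integrable_ballPotential_mul {f : E → ℝ} (hf : Continuous f) :
    Integrable (fun y => ballPotential y * f y) :=
  (continuous_ballPotential.mul hf).integrable_of_hasCompactSupport
    (hasCompactSupport_of_eq_zero_of_one_le_norm fun y hy => by simp [ballPotential_eq_zero hy])

lemma integrable_ballWeight_mul {f : E → ℝ} (hf : Continuous f) :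
    Integrable (fun y => ballWeight y * f y) :=
  (continuous_ballWeight.mul hf).integrable_of_hasCompactSupport
    (hasCompactSupport_of_eq_zero_of_one_le_norm fun y hy => by simp [ballWeight_eq_zero hy])

lemma integrable_ballPotential : Integrable (ballPotential : E → ℝ) := by
  simpa using integrable_ballPotential_mul (E := E) (continuous_const (y := (1 : ℝ)))

lemma integrable_ballWeight : Integrable (ballWeight : E → ℝ) := by
  simpa using integrable_ballWeight_mul (E := E) (continuous_const (y := (1 : ℝ)))

lemma integral_ballWeight_pos : 0 < ∫ y : E, ballWeight y := by
  refine continuous_ballWeight.integral_pos_of_hasCompactSupport_nonneg_nonzero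
    (hasCompactSupport_of_eq_zero_of_one_le_norm fun y hy => ballWeight_eq_zero hy)
    ballWeight_nonneg (x := 0) (by simp [ballWeight])

/-- Since `ballWeight y • y` is minus the gradient of the compactly supported `ballPotential`,
integration by parts in each coordinate leaves no boundary term; the factor `t` is the chain rule.
-/
lemma integral_ballWeight_mul_fderiv {v : E → ℝ} (hv : ContDiff ℝ 2 v) (x : E) (t : ℝ) :
    ∫ y, ballWeight y * fderiv ℝ v (x + t • y) y =
      t * ∫ y, ballPotential y * Laplacian.laplacian v (x + t • y) := by
  set b := stdOrthonormalBasis ℝ E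
  have hv1 : ContDiff ℝ 1 (fderiv ℝ v) := hv.fderiv_right (by norm_num)
  have hc1 : Continuous (fderiv ℝ v) := hv1.continuous
  have hc2 : Continuous (fderiv ℝ (fderiv ℝ v)) := hv1.continuous_fderiv (by norm_num)
  have haff : ∀ y : E, HasFDerivAt (fun y : E => x + t • y) (t • ContinuousLinearMap.id ℝ E) y :=
    fun y => ((hasFDerivAt_id y).const_smul t).const_add x
  have hg : ∀ i y, HasFDerivAt (fun y => fderiv ℝ v (x + t • y) (b i))
      ((ContinuousLinearMap.apply ℝ ℝ (b i)).comp
        ((fderiv ℝ (fderiv ℝ v) (x + t • y)).comp (t • ContinuousLinearMap.id ℝ E))) y :=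
    fun i y => (ContinuousLinearMap.apply ℝ ℝ (b i)).hasFDerivAt.comp y
      (((hv1.differentiable (by norm_num)) _).hasFDerivAt.comp y (haff y))
  have key : ∀ i, ∫ y, ballWeight y * (inner ℝ (b i) y * fderiv ℝ v (x + t • y) (b i)) =
      ∫ y, ballPotential y * (t * fderiv ℝ (fderiv ℝ v) (x + t • y) (b i) (b i)) := by
    intro i
    have hd : ∀ y, fderiv ℝ (ballPotential : E → ℝ) y (b i) = -(ballWeight y * inner ℝ (b i) y) := by
      intro y
      rw [(hasFDerivAt_ballPotential y).fderiv]
      simp [real_inner_comm]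
    have hd2 : ∀ y, fderiv ℝ (fun y => fderiv ℝ v (x + t • y) (b i)) y (b i) =
        t * fderiv ℝ (fderiv ℝ v) (x + t • y) (b i) (b i) := by
      intro y
      rw [(hg i y).fderiv]
      simp
    have hcg : Continuous fun y => fderiv ℝ v (x + t • y) (b i) := by fun_prop
    have hcg2 : Continuous fun y => t * fderiv ℝ (fderiv ℝ v) (x + t • y) (b i) (b i) := by
      fun_prop
    have := integral_mul_fderiv_eq_neg_fderiv_mul_of_integrable (μ := (volume : Measure E))
      (f := ballPotential) (g := fun y => fderiv ℝ v (x + t • y) (b i)) (v := b i)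
      ?_ ?_ (integrable_ballPotential_mul hcg)
      (fun y _ => (hasFDerivAt_ballPotential y).differentiableAt)
      (fun y _ => (hg i y).differentiableAt)
    · simp only [hd, hd2, neg_mul, integral_neg, neg_neg, mul_assoc] at this
      exact this.symm
    · simp only [hd, neg_mul, mul_assoc]
      exact (integrable_ballWeight_mul (by fun_prop)).neg
    · simp only [hd2]
      exact integrable_ballPotential_mul hcg2
  calc ∫ y, ballWeight y * fderiv ℝ v (x + t • y) y
      = ∫ y, ∑ i, ballWeight y * (inner ℝ (b i) y * fderiv ℝ v (x + t • y) (b i)) := by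
        congr 1 with y
        rw [← Finset.mul_sum]
        congr 1
        have h := congrArg (fderiv ℝ v (x + t • y)) (b.sum_repr' y)
        simpa using h.symm
    _ = ∑ i, ∫ y, ballPotential y * (t * fderiv ℝ (fderiv ℝ v) (x + t • y) (b i) (b i)) := by
        rw [integral_finsetSum _ fun i _ => integrable_ballWeight_mul (by fun_prop)]
        exact Finset.sum_congr rfl fun i _ => key i
    _ = ∫ y, ∑ i, ballPotential y * (t * fderiv ℝ (fderiv ℝ v) (x + t • y) (b i) (b i)) := by
        rw [integral_finsetSum _ fun i _ => integrable_ballPotential_mul (by fun_prop)]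
    _ = _ := by
        rw [← integral_const_mul]
        congr 1 with y
        rw [InnerProductSpace.laplacian_eq_iteratedFDeriv_orthonormalBasis v b]
        simp only [iteratedFDeriv_two_apply, Finset.mul_sum]
        refine Finset.sum_congr rfl fun i _ => ?_
        simp
        ring

lemma hasDerivAt_integral_ballWeight_mul {v : E → ℝ} (hv : ContDiff ℝ 1 v) (x : E) (t : ℝ) :
    HasDerivAt (fun t : ℝ => ∫ y, ballWeight y * v (x + t • y))
      (∫ y, ballWeight y * fderiv ℝ v (x + t • y) y) t := by
  have hc1 : Continuous (fderiv ℝ v) := hv.continuous_fderiv (by norm_num)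
  have hc : Continuous v := hv.continuous
  -- The weight vanishes off the unit ball, so a bound on this compact set dominates the derivative
  -- for all parameters near `t`.
  obtain ⟨M, hM⟩ := (((isCompact_closedBall t 1).prod (isCompact_closedBall (0 : E) 1)).image
    (f := fun p : ℝ × E => fderiv ℝ v (x + p.1 • p.2) p.2) (by fun_prop)).isBounded.exists_norm_le
  refine (hasDerivAt_integral_of_dominated_loc_of_deriv_le (s := Metric.closedBall t 1)
    (F := fun t y => ballWeight y * v (x + t • y))
    (F' := fun t y => ballWeight y * fderiv ℝ v (x + t • y) y)
    (bound := fun y => ballWeight y * M) (Metric.closedBall_mem_nhds t one_pos)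
    (Eventually.of_forall fun s => (integrable_ballWeight_mul (by fun_prop)).aestronglyMeasurable)
    (integrable_ballWeight_mul (by fun_prop))
    (integrable_ballWeight_mul (by fun_prop)).aestronglyMeasurable
    (Eventually.of_forall fun y s hs => ?_) (integrable_ballWeight.mul_const M)
    (Eventually.of_forall fun y s _ => ?_)).2
  · rw [norm_mul, Real.norm_of_nonneg (ballWeight_nonneg y)]
    rcases le_total 1 ‖y‖ with hy | hy
    · simp [ballWeight_eq_zero hy]
    · exact mul_le_mul_of_nonneg_left
        (hM _ ⟨(s, y), ⟨hs, mem_closedBall_zero_iff.2 hy⟩, rfl⟩) (ballWeight_nonneg y)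
  · have h1 : HasDerivAt (fun s : ℝ => x + s • y) y s := by
      simpa using ((hasDerivAt_id s).smul_const y).const_add x
    exact (((hv.differentiable (by norm_num)) _).hasFDerivAt.comp_hasDerivAt s h1).const_mul _

/-- The average at scale `t` has derivative at most `t K ∫ φ ≤ s K ∫ φ` in absolute value on `[0,
s]`, and at `t = 0` it is `v x` times the total weight. -/
lemma abs_integral_ballWeight_mul_sub_le {v : E → ℝ} (hv : ContDiff ℝ 2 v) {x : E} {s K : ℝ}
    (hs : 0 ≤ s) (hK : ∀ z ∈ Metric.closedBall x s, |Laplacian.laplacian v z| ≤ K) :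
    |(∫ y, ballWeight y * v (x + s • y)) - (∫ y : E, ballWeight y) * v x| ≤
      s ^ 2 * K * ∫ y : E, ballPotential y := by
  have hK0 : 0 ≤ K := (abs_nonneg _).trans (hK x (Metric.mem_closedBall_self hs))
  have := norm_image_sub_le_of_norm_deriv_le_segment'
    (f := fun t : ℝ => ∫ y, ballWeight y * v (x + t • y)) (a := 0) (b := s)
    (C := s * (K * ∫ y : E, ballPotential y))
    (fun t _ => (hasDerivAt_integral_ballWeight_mul (hv.of_le (by norm_num)) x t).hasDerivWithinAt)
    (fun t ht => ?_) s (right_mem_Icc.2 hs)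
  · simp only [zero_smul, add_zero, sub_zero, integral_mul_const, Real.norm_eq_abs] at this
    exact this.trans_eq (by ring)
  · rw [integral_ballWeight_mul_fderiv hv, norm_mul, Real.norm_of_nonneg ht.1]
    refine mul_le_mul ht.2.le ?_ (norm_nonneg _) hs
    rw [← integral_const_mul]
    refine norm_integral_le_of_norm_le (integrable_ballPotential.const_mul K)
      (Eventually.of_forall fun y => ?_)
    rw [norm_mul, Real.norm_of_nonneg (ballPotential_nonneg y), mul_comm]
    rcases le_total 1 ‖y‖ with hy | hy
    · simp [ballPotential_eq_zero hy]
    · refine mul_le_mul_of_nonneg_right (hK _ ?_) (ballPotential_nonneg y)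
      rw [mem_closedBall_iff_norm, add_sub_cancel_left, norm_smul, Real.norm_of_nonneg ht.1]
      nlinarith [ht.1, ht.2, norm_nonneg y]

/-- A quantitative mean value property: the weighted average over a ball of radius `s` differs
from the value at the centre by at most `s²` times the supremum of the Laplacian. -/
lemma abs_integral_ballWeight_mul_sub_le_of_contDiffOn {u : E → ℝ} {x : E} {s r K : ℝ}
    (hs : 0 < s) (hsr : s < r) (hu : ContDiffOn ℝ 2 u (Metric.ball x r))
    (hK : ∀ z ∈ Metric.closedBall x s, |Laplacian.laplacian u z| ≤ K) :
    |(∫ y, ballWeight y * u (x + s • y)) - (∫ y : E, ballWeight y) * u x| ≤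
      s ^ 2 * K * ∫ y : E, ballPotential y := by
  obtain ⟨v, hv, hvu⟩ := exists_contDiff_eqOn_ball (s := (s + r) / 2) (by linarith)
    (by linarith) hu
  have hsub : Metric.closedBall x s ⊆ Metric.ball x ((s + r) / 2) :=
    Metric.closedBall_subset_ball (by linarith)
  have h1 : ∫ y, ballWeight y * u (x + s • y) = ∫ y, ballWeight y * v (x + s • y) := by
    congr 1 with y
    rcases le_total 1 ‖y‖ with hy | hy
    · simp [ballWeight_eq_zero hy]
    · rw [hvu (hsub _)]
      rw [mem_closedBall_iff_norm, add_sub_cancel_left, norm_smul, Real.norm_of_nonneg hs.le]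
      nlinarith
  rw [h1, ← hvu (hsub (Metric.mem_closedBall_self hs.le))]
  refine abs_integral_ballWeight_mul_sub_le hv hs.le fun z hz => ?_
  rw [(InnerProductSpace.laplacian_congr_nhds
    (hvu.eventuallyEq_of_mem (Metric.isOpen_ball.mem_nhds (hsub hz)))).eq_of_nhds]
  exact hK z hz

end MeanValue

/-! ### Local boundedness and small-energy regularity. -/

section MeanValueHolder

variable {E : Type*} [NormedAddCommGroup E] [InnerProductSpace ℝ E] [FiniteDimensional ℝ E]
  [MeasurableSpace E] [BorelSpace E]

/-- The weight is at most 4 and lives on the unit ball; Hölder against the constant 1 does the rest.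
-/
lemma abs_integral_ballWeight_mul_le {f : E → ℝ} {q : ℝ} (hq : 1 < q)
    (hf : ContinuousOn f (Metric.closedBall 0 1)) :
    |∫ y, ballWeight y * f y| ≤ 4 * (volume.real (Metric.ball (0 : E) 1) ^ (1 / q.conjExponent) *
      (∫ y in Metric.ball 0 1, |f y| ^ q) ^ (1 / q)) := by
  have hpq : q.HolderConjugate q.conjExponent := Real.HolderConjugate.conjExponent hq
  obtain ⟨M, hM⟩ := ((isCompact_closedBall (0 : E) 1).image_of_continuousOn
    hf).isBounded.exists_norm_le
  have hfin : IsFiniteMeasure (volume.restrict (Metric.ball (0 : E) 1)) :=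
    isFiniteMeasure_restrict.2 measure_ball_lt_top.ne
  have hmeas : AEStronglyMeasurable f (volume.restrict (Metric.ball (0 : E) 1)) :=
    (hf.mono Metric.ball_subset_closedBall).aestronglyMeasurable measurableSet_ball
  have hbd : ∀ᵐ y ∂(volume.restrict (Metric.ball (0 : E) 1)), ‖f y‖ ≤ M :=
    (ae_restrict_iff' measurableSet_ball).2 (Eventually.of_forall fun y hy =>
      hM _ (mem_image_of_mem f (Metric.ball_subset_closedBall hy)))
  have hLp : ∀ p, MemLp f p (volume.restrict (Metric.ball (0 : E) 1)) :=
    fun p => MemLp.of_bound hmeas M hbd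
  have hint : Integrable (fun y => |f y|) (volume.restrict (Metric.ball (0 : E) 1)) :=
    (memLp_one_iff_integrable.1 (hLp 1)).abs
  have h1 : |∫ y, ballWeight y * f y| ≤ 4 * ∫ y in Metric.ball 0 1, |f y| := by
    have h0 : ∫ y in Metric.ball 0 1, ballWeight y * f y = ∫ y, ballWeight y * f y :=
      setIntegral_eq_integral_of_forall_compl_eq_zero fun y hy => by
        rw [ballWeight_eq_zero (by simpa using hy), zero_mul]
    rw [← h0, ← integral_const_mul, ← Real.norm_eq_abs]
    refine norm_integral_le_of_norm_le (hint.const_mul 4) (Eventually.of_forall fun y => ?_)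
    rw [norm_mul, Real.norm_of_nonneg (ballWeight_nonneg y)]
    exact mul_le_mul_of_nonneg_right (ballWeight_le y) (abs_nonneg _)
  have h2 := integral_mul_norm_le_Lp_mul_Lq hpq (hLp _)
    (memLp_const (μ := volume.restrict (Metric.ball (0 : E) 1)) (1 : ℝ))
  simp only [norm_one, mul_one, Real.one_rpow, Real.norm_eq_abs, integral_const, smul_eq_mul,
    measureReal_restrict_apply_univ] at h2
  rw [mul_comm (_ ^ _)]
  linarith

lemma setIntegral_unitBall_comp_add_smul (g : E → ℝ) (x : E) {s : ℝ} (hs : 0 < s) :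
    ∫ y in Metric.ball 0 1, g (x + s • y) =
      (s ^ Module.finrank ℝ E)⁻¹ * ∫ y in Metric.ball x s, g y := by
  have h1 := Measure.setIntegral_comp_smul_of_pos volume (fun y => g (x + y))
    (Metric.ball (0 : E) 1) hs
  rw [h1, smul_unitBall_of_pos hs, smul_eq_mul]
  congr 1
  have h2 := (measurePreserving_add_left (volume : Measure E) x).setIntegral_preimage_emb
    (measurableEmbedding_addLeft x) g (Metric.ball x s)
  rw [← h2]
  congr 3
  ext y
  simp

/-- Local boundedness: the value at the centre of a ball is controlled by the supremum of the
Laplacian and the scaled `L^q` norm. -/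
lemma exists_abs_le_laplacian_add_Lp {q : ℝ} (hq : 1 < q) :
    ∃ A > 0, ∃ B > 0, ∀ (u : E → ℝ) (x : E) (s r K : ℝ), 0 < s → s < r →
      ContDiffOn ℝ 2 u (Metric.ball x r) →
      (∀ z ∈ Metric.closedBall x s, |Laplacian.laplacian u z| ≤ K) →
      |u x| ≤ A * (s ^ 2 * K) +
        B * ((s ^ Module.finrank ℝ E)⁻¹ * ∫ y in Metric.ball x s, |u y| ^ q) ^ (1 / q) := by
  set H := ∫ y : E, ballWeight y
  set Z := ∫ y : E, ballPotential y
  set W := volume.real (Metric.ball (0 : E) 1) ^ (1 / q.conjExponent)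
  have hH : 0 < H := integral_ballWeight_pos
  have hZ : 0 ≤ Z := integral_nonneg ballPotential_nonneg
  have hW : 0 ≤ W := by positivity
  refine ⟨H⁻¹ * (Z + 1), by positivity, H⁻¹ * (4 * W + 1), by positivity,
    fun u x s r K hs hsr hu hK => ?_⟩
  have hK0 : 0 ≤ K := (abs_nonneg _).trans (hK x (Metric.mem_closedBall_self hs.le))
  have h1 := abs_integral_ballWeight_mul_sub_le_of_contDiffOn hs hsr hu hK
  have hc : ContinuousOn (fun y => u (x + s • y)) (Metric.closedBall 0 1) := by
    refine hu.continuousOn.comp (by fun_prop) fun y hy => ?_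
    rw [mem_closedBall_zero_iff] at hy
    rw [mem_ball_iff_norm, add_sub_cancel_left, norm_smul, Real.norm_of_nonneg hs.le]
    nlinarith
  have h2 := abs_integral_ballWeight_mul_le hq hc
  rw [setIntegral_unitBall_comp_add_smul (fun y => |u y| ^ q) x hs] at h2
  set J := ((s ^ Module.finrank ℝ E)⁻¹ * ∫ y in Metric.ball x s, |u y| ^ q) ^ (1 / q)
  have hJ : 0 ≤ J := Real.rpow_nonneg (mul_nonneg (by positivity)
    (integral_nonneg fun y => by positivity)) _
  have h3 : H * |u x| ≤ s ^ 2 * K * Z + 4 * (W * J) := by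
    rw [← abs_of_pos hH, ← abs_mul]
    have := abs_sub_abs_le_abs_sub (H * u x) (∫ y, ballWeight y * u (x + s • y))
    rw [abs_sub_comm] at this
    linarith
  have h4 : H * |u x| ≤ (Z + 1) * (s ^ 2 * K) + (4 * W + 1) * J := by
    have : 0 ≤ s ^ 2 * K := by positivity
    linarith
  calc |u x| = H⁻¹ * (H * |u x|) := by field_simp
    _ ≤ H⁻¹ * ((Z + 1) * (s ^ 2 * K) + (4 * W + 1) * J) := by gcongr
    _ = _ := by ring

/-- `ε`-regularity for the critical equation, with `α = (n - 2) / 2`. -/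
lemma exists_abs_le_of_critical_energy_small {α : ℝ} (hα : 0 < α)
    (hdim : (Module.finrank ℝ E : ℝ) = 2 * α + 2) :
    ∃ ε₀ > 0, ∃ D ≥ 0, ∀ (u : E → ℝ) (x₀ : E) (ε : ℝ),
      ContDiffOn ℝ 2 u (Metric.ball x₀ 1) →
      (∀ z ∈ Metric.ball x₀ 1, |Laplacian.laplacian u z| ≤ |u z| ^ (1 + 2 / α)) →
      IntegrableOn (fun y => |u y| ^ ((2 * α + 2) / α)) (Metric.ball x₀ 1) →
      ∫ y in Metric.ball x₀ 1, |u y| ^ ((2 * α + 2) / α) ≤ ε → ε ≤ ε₀ →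
      ∀ x ∈ Metric.ball x₀ (1 / 2), |u x| ≤ D * ε ^ (α / (2 * α + 2)) := by
  set q := (2 * α + 2) / α with hqdef
  have hq : 1 < q := by rw [hqdef, lt_div_iff₀ hα]; linarith
  have hq0 : 0 < q := by linarith
  have hqinv : α / (2 * α + 2) = 1 / q := by rw [hqdef, one_div_div]
  obtain ⟨A, hA, B, hB, hAB⟩ := exists_abs_le_laplacian_add_Lp (E := E) hq
  set P : ℝ := (2 ^ α) ^ (1 + 2 / α) with hP
  have hP0 : 0 < P := by positivity
  set a : ℝ := √(1 / (2 * A * P))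
  -- `a` is chosen so that, at scales up to `a m^(-1/α)`, the Laplacian term is at most `m / 2`.
  have ha : 0 < a := Real.sqrt_pos.2 (by positivity)
  have ha2 : A * (a ^ 2 * P) = 1 / 2 := by
    rw [Real.sq_sqrt (by positivity)]; field_simp
  -- This threshold gives `2B ε^(1/q) ≤ a^α / 2 < a^α`, which rules out the intrinsic scale below.
  refine ⟨(a ^ α / (4 * B)) ^ q, by positivity, 4 ^ α * (2 ^ α * (2 * B)), by positivity,
    fun u x₀ ε hu hΔ hint hI hε x hx => ?_⟩
  rw [hqinv]
  have hI0 : 0 ≤ ∫ y in Metric.ball x₀ 1, |u y| ^ q := integral_nonneg fun y => by positivity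
  have hε0 : 0 ≤ ε := hI0.trans hI
  have hsmall : 2 * B * ε ^ (1 / q) < a ^ α := by
    have : ε ^ (1 / q) ≤ a ^ α / (4 * B) := by
      refine (Real.rpow_le_rpow hε0 hε (by positivity)).trans_eq ?_
      rw [← Real.rpow_mul (by positivity), mul_one_div_cancel hq0.ne', Real.rpow_one]
    calc 2 * B * ε ^ (1 / q) ≤ 2 * B * (a ^ α / (4 * B)) := by gcongr
      _ = a ^ α / 2 := by field_simp; ring
      _ < a ^ α := half_lt_self (by positivity)
  -- Point picking: maximise the weighted size of `u`.
  have hsub : Metric.closedBall x₀ (3 / 4) ⊆ Metric.ball x₀ 1 :=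
    Metric.closedBall_subset_ball (by norm_num)
  have hcont : ContinuousOn (fun z => (3 / 4 - dist z x₀) ^ α * |u z|)
      (Metric.closedBall x₀ (3 / 4)) :=
    (ContinuousOn.rpow_const (by fun_prop) fun _ _ => Or.inr hα.le).mul
      (hu.continuousOn.mono hsub).abs
  obtain ⟨x₁, hx₁, hmax⟩ := (isCompact_closedBall x₀ (3 / 4)).exists_isMaxOn
    ⟨x₀, Metric.mem_closedBall_self (by norm_num)⟩ hcont
  have hmax' : ∀ z ∈ Metric.closedBall x₀ (3 / 4),
      (3 / 4 - dist z x₀) ^ α * |u z| ≤ (3 / 4 - dist x₁ x₀) ^ α * |u x₁| := fun z hz => hmax hz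
  set d := 3 / 4 - dist x₁ x₀ with hd
  have hd0 : 0 ≤ d := by rw [Metric.mem_closedBall] at hx₁; linarith
  -- On the ball of radius `1/2` the weight `3/4 - dist z x₀` is at least `1/4`, so a bound on the
  -- maximum costs only the factor `4^α`.
  suffices hmain : d ^ α * |u x₁| ≤ 2 ^ α * (2 * B) * ε ^ (1 / q) by
    rw [Metric.mem_ball] at hx
    have h1 := hmax' x (by rw [Metric.mem_closedBall]; linarith)
    have h2 : (1 / 4 : ℝ) ^ α * |u x| ≤ (3 / 4 - dist x x₀) ^ α * |u x| := by
      gcongr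
      linarith
    calc |u x| = 4 ^ α * ((1 / 4 : ℝ) ^ α * |u x|) := by
          rw [← mul_assoc, ← Real.mul_rpow (by norm_num) (by norm_num)]; norm_num
      _ ≤ 4 ^ α * (2 ^ α * (2 * B) * ε ^ (1 / q)) := by
          exact mul_le_mul_of_nonneg_left (h2.trans (h1.trans hmain)) (by positivity)
      _ = _ := by ring
  have hrhs : 0 ≤ 2 ^ α * (2 * B) * ε ^ (1 / q) := by positivity
  rcases hd0.eq_or_lt with hd0 | hd0
  · rw [← hd0, Real.zero_rpow hα.ne', zero_mul]; exact hrhs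
  rcases (abs_nonneg (u x₁)).eq_or_lt with hu0 | hu0
  · rw [← hu0, mul_zero]; exact hrhs
  set m := |u x₁|
  -- Estimate on every ball of radius at most `d / 2` and at most the intrinsic scale.
  have hest : ∀ s, 0 < s → s ≤ d / 2 → s ≤ a * m ^ (-(1 / α)) →
      s ^ α * m ≤ 2 * B * ε ^ (1 / q) := by
    intro s hs hsd hsm
    have hballs : Metric.ball x₁ d ⊆ Metric.ball x₀ 1 :=
      Metric.ball_subset_ball' (by linarith)
    have hlap : ∀ z ∈ Metric.closedBall x₁ s, |Laplacian.laplacian u z| ≤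
        P * m ^ (1 + 2 / α) := by
      intro z hz
      rw [Metric.mem_closedBall] at hz
      have htri := dist_triangle z x₁ x₀
      -- Within `d / 2` of `x₁` the weight drops by at most half, so maximality yields `|u z| ≤ 2^α
      -- m`.
      have hz2 : d / 2 ≤ 3 / 4 - dist z x₀ := by linarith
      have h1 := hmax' z (by rw [Metric.mem_closedBall]; linarith)
      have h2 : (d / 2) ^ α * |u z| ≤ d ^ α * m := by
        refine le_trans ?_ h1
        gcongr
      have h3 : |u z| ≤ 2 ^ α * m := by
        rw [Real.div_rpow hd0.le zero_le_two, div_mul_eq_mul_div, div_le_iff₀ (by positivity)] at h2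
        have hdα : 0 < d ^ α := by positivity
        refine le_of_mul_le_mul_left (h2.trans_eq ?_) hdα
        ring
      refine (hΔ z (hballs (Metric.mem_ball.2 (by linarith)))).trans ?_
      rw [hP, ← Real.mul_rpow (by positivity) hu0.le]
      gcongr
    have hmv := hAB u x₁ s d _ hs (by linarith) (hu.mono hballs) hlap
    have hs2 : s ^ 2 * m ^ (2 / α) ≤ a ^ 2 := by
      have h1 : s * m ^ (1 / α) ≤ a := by
        rw [Real.rpow_neg hu0.le, ← div_eq_mul_inv, le_div_iff₀ (by positivity)] at hsm
        exact hsm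
      have h2 : m ^ (2 / α) = (m ^ (1 / α)) ^ 2 := by
        rw [← Real.rpow_natCast, ← Real.rpow_mul hu0.le]
        congr 1
        push_cast; ring
      rw [h2, ← mul_pow]
      gcongr
    have hfirst : A * (s ^ 2 * (P * m ^ (1 + 2 / α))) ≤ 1 / 2 * m := by
      rw [Real.rpow_add hu0, Real.rpow_one, ← ha2]
      calc A * (s ^ 2 * (P * (m * m ^ (2 / α)))) = A * ((s ^ 2 * m ^ (2 / α)) * P) * m := by ring
        _ ≤ A * (a ^ 2 * P) * m := by gcongr
    have hsecond : ((s ^ Module.finrank ℝ E)⁻¹ * ∫ y in Metric.ball x₁ s, |u y| ^ q) ^ (1 / q) ≤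
        (s ^ α)⁻¹ * ε ^ (1 / q) := by
      have h1 : ∫ y in Metric.ball x₁ s, |u y| ^ q ≤ ε :=
        (setIntegral_mono_set hint (Eventually.of_forall fun y => by positivity)
          ((Metric.ball_subset_ball (by linarith)).trans hballs).eventuallyLE).trans hI
      have h2 : (0 : ℝ) ≤ ∫ y in Metric.ball x₁ s, |u y| ^ q :=
        integral_nonneg fun y => by positivity
      calc _ ≤ ((s ^ Module.finrank ℝ E)⁻¹ * ε) ^ (1 / q) := by gcongr
        _ = _ := by
          -- Criticality enters here: the dimension divided by `q` is exactly `α`.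
          rw [Real.mul_rpow (by positivity) hε0, Real.inv_rpow (by positivity),
            ← Real.rpow_natCast, ← Real.rpow_mul hs.le, hdim, hqdef, mul_one_div,
            div_div_cancel₀ (by positivity)]
    have h5 : m ≤ 2 * (B * ((s ^ α)⁻¹ * ε ^ (1 / q))) := by
      have : B * _ ≤ B * _ := mul_le_mul_of_nonneg_left hsecond hB.le
      linarith
    have hsα : 0 < s ^ α := by positivity
    calc s ^ α * m ≤ s ^ α * (2 * (B * ((s ^ α)⁻¹ * ε ^ (1 / q)))) := by gcongr
      _ = _ := by field_simp
  -- The intrinsic scale is excluded by smallness of the energy.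
  have hscale : d / 2 ≤ a * m ^ (-(1 / α)) := by
    by_contra! hlt
    have h1 := hest _ (by positivity) hlt.le le_rfl
    -- At `s = a m^(-1/α)` the quantity `s^α m` equals `a^α`, contradicting `hsmall`.
    rw [Real.mul_rpow ha.le (by positivity), ← Real.rpow_mul hu0.le, neg_mul,
      one_div_mul_cancel hα.ne', Real.rpow_neg_one, mul_assoc, inv_mul_cancel₀ hu0.ne',
      mul_one] at h1
    linarith
  have h1 := hest (d / 2) (by positivity) le_rfl hscale
  calc d ^ α * m = 2 ^ α * ((d / 2) ^ α * m) := by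
        rw [← mul_assoc, ← Real.mul_rpow zero_le_two (by positivity), mul_div_cancel₀ _ two_ne_zero]
    _ ≤ 2 ^ α * (2 * B * ε ^ (1 / q)) := by gcongr
    _ = _ := by ring

end MeanValueHolder

/-! ### The critical equation in dimension `n`. -/

theorem theorem1p2 (n : ℕ) (hn : 3 ≤ n) :
    ∃ ε₀ : ℝ, 0 < ε₀ ∧ ∃ r₀ : ℝ, 0 < r₀ ∧ ∃ C : ℝ → ℝ, Tendsto C (𝓝[>] 0) (𝓝 0) ∧
      ∀ (Ω : Set (EuclideanSpace ℝ (Fin n))) (u : EuclideanSpace ℝ (Fin n) → ℝ),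
        IsOpen Ω → IsClassicalSolution Ω u → MemHOne Ω u →
        MemLp u (ENNReal.ofReal (critExponent n)) (volume.restrict Ω) →
        ∀ x₀ ∈ Ω, Metric.ball x₀ r₀ ⊆ Ω →
        ∀ ε : ℝ, 0 < ε → ε ≤ ε₀ → ballEnergy u x₀ r₀ ≤ ε →
        ∀ r : ℝ, 0 < r → r < r₀ →
          eLpNorm u ⊤ (volume.restrict (Metric.ball x₀ (r / 2))) ≤
            ENNReal.ofReal (C ε / r ^ (((n : ℝ) - 2) / 2)) := by
  have hn' : (3 : ℝ) ≤ n := by exact_mod_cast hn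
  set α : ℝ := ((n : ℝ) - 2) / 2 with hα
  have hα0 : 0 < α := by rw [hα]; linarith
  have hcrit : critExponent n = (2 * α + 2) / α := by
    rw [critExponent, hα]
    field_simp
    ring
  obtain ⟨ε₀, hε₀, D, hD, hmain⟩ := exists_abs_le_of_critical_energy_small
    (E := EuclideanSpace ℝ (Fin n)) hα0 (by rw [finrank_euclideanSpace_fin, hα]; ring)
  have hexp : 0 < α / (2 * α + 2) := by positivity
  -- With `r₀ = 1`, every `r < r₀` has `r^α ≤ 1`, so the uniform bound on the ball of radius `1/2`
  -- already implies the scaled one.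
  refine ⟨ε₀, hε₀, 1, one_pos, fun ε => D * ε ^ (α / (2 * α + 2)), ?_, ?_⟩
  · have h : ContinuousAt (fun ε : ℝ => D * ε ^ (α / (2 * α + 2))) 0 :=
      (Real.continuousAt_rpow_const 0 _ (Or.inr hexp.le)).const_mul D
    simpa [ContinuousAt, Real.zero_rpow hexp.ne'] using h.mono_left nhdsWithin_le_nhds
  intro Ω u _ hsol hH hLp x₀ _ hball ε hε hεε₀ hE r hr hr1
  have hq0 : 0 < critExponent n := by rw [hcrit]; positivity
  have hint : IntegrableOn (fun y => |u y| ^ critExponent n) (Metric.ball x₀ 1) := by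
    have := hLp.integrable_norm_rpow (by simpa using hq0) ENNReal.ofReal_ne_top
    rw [ENNReal.toReal_ofReal hq0.le] at this
    exact IntegrableOn.mono_set this hball
  have hgrad : IntegrableOn (fun y => ‖gradient u y‖ ^ 2) (Metric.ball x₀ 1) :=
    IntegrableOn.mono_set (hH.memLp_gradient.integrable_norm_pow two_ne_zero) hball
  have hI : ∫ y in Metric.ball x₀ 1, |u y| ^ critExponent n ≤ ε := by
    refine le_trans ?_ hE
    exact integral_mono hint (hgrad.add hint) fun y => le_add_of_nonneg_left (by positivity)
  have hlap : ∀ z ∈ Metric.ball x₀ 1, |Laplacian.laplacian u z| ≤ |u z| ^ (1 + 2 / α) := by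
    intro z hz
    have h2 : 4 / ((n : ℝ) - 2) = 2 / α := by rw [hα, div_div_eq_mul_div]; norm_num
    rw [← abs_neg, hsol.eqn z (hball hz), abs_mul, h2,
      abs_of_nonneg (Real.rpow_nonneg (abs_nonneg _) _)]
    rcases (abs_nonneg (u z)).eq_or_lt with h0 | h0
    · rw [← h0, zero_mul]; positivity
    · rw [Real.rpow_add h0, Real.rpow_one]
  have hbd := hmain u x₀ ε (hsol.contDiffOn.mono hball) hlap (by rwa [← hcrit])
    (by rwa [← hcrit]) hεε₀
  rw [eLpNorm_exponent_top]
  refine eLpNormEssSup_le_of_ae_bound ((ae_restrict_iff' measurableSet_ball).2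
    (Eventually.of_forall fun x hx => ?_))
  refine (hbd x (Metric.ball_subset_ball (by linarith) hx)).trans ?_
  exact le_div_self (by positivity) (by positivity) (Real.rpow_le_one hr.le hr1.le hα0.le)
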